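/- **Theorem 3.1.** For a function $H:[0,\infty)\to(0,\infty)$ consider, on a probability space, the multifractional Brownian motion (mBm) with Hurst function $H$ in the moving average representation $$B(t)=\frac{1}{\Gamma(H(t)+\frac12)}\left(\int_{-\infty}^0\big[(t-u)^{H(t)-1/2}-(-u)^{H(t)-1/2}\big]\,W(du)+\int_0^t (t-u)^{H(t)-1/2}\,W(du)\right),\qquad t\ge 0, \tag{2}$$ where $W$ is a standard Brownian motion on $\mathbb R$, or in the harmonizable representation $$B(t)=\int_{\mathbb R}\frac{e^{it\xi}-1}{|\xi|^{H(t)+1/2}}\,\widehat W(d\xi),\qquad t\ge 0, \tag{3}$$ where $\widehat W=\sum_n\eta_n\widehat{e_n}$ is the Fourier transform of white noise: $(e_n)$ is an orthonormal basis of the real space $L^2(\mathbb R)$, $(\eta_n)$ are independent standard Gaussian variables, and $\int f\,d\widehat W=\sum_n\eta_n\int f(\xi)\,\widehat{e_n}(\xi)\,d\xi$ with convergence in mean square. Both stochastic integrals are defined for square-integrable integrands, and are set to $0$ for the other integrands. The process $B$ is assumed to be jointly measurable in $(t,\omega)$. Say that $B$ has a *square-integrable local time* on $[a,b]$ if, almost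 surely, the occupation measure $A\mapsto\lambda\{s\in[a,b]:B(s)\in A\}$ is absolutely continuous with respect to Lebesgue measure on $\mathbb R$, with a density $L([a,b],\cdot)\in L^2(\mathbb R)$. 1. Let $H$ be measurable with values in $[\mu,\nu]$ for some $0<\mu\le\nu<1$. Then the mBm (2) has a square-integrable local time on every interval $[a,b]\subset[0,\infty)$, and moreover $\mathbb E\int_{\mathbb R}L([a,b],x)^2\,dx<\infty$. 2. Let $B$ be given by (2) or by (3), where $H:[0,\infty)\to(0,\infty)$ satisfies, for some $\beta$, the condition $(\mathcal H_\beta)$: $H$ is $\beta$-Hölder continuous and $\sup_{s\ge0}H(s)<\beta$. No upper bound $H<1$ is assumed. If $B$ has a square-integrable local time on every interval $[a,b]\subset[0,\infty)$, then $H(t)<1$ for almost all $t\ge0$. -/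

import Mathlib

open MeasureTheory ProbabilityTheory Filter Topology
open scoped NNReal ENNReal FourierTransform

noncomputable section

namespace MBm

/-! ### Brownian motion on the line and the Wiener integral -/

/-- Standard Brownian motion `W = (W u, u ∈ ℝ)` on the whole real line. -/
structure IsTwoSidedBrownian {Ω : Type*} [MeasurableSpace Ω] (P : Measure Ω)
    (W : ℝ → Ω → ℝ) : Prop where
  zero : ∀ᵐ ω ∂P, W 0 ω = 0
  indep : HasIndepIncrements W P
  law : ∀ s t : ℝ, s ≤ t →
    HasLaw (fun ω => W t ω - W s ω) (gaussianReal 0 (t - s).toNNReal) P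
  continuous : ∀ᵐ ω ∂P, Continuous fun u => W u ω

/-- A finite linear combination of indicators of intervals `(lo i, hi i]`. -/
structure StepFun where
  n : ℕ
  coeff : Fin n → ℝ
  lo : Fin n → ℝ
  hi : Fin n → ℝ
  le : ∀ i, lo i ≤ hi i

/-- The function `u ↦ ∑ i, coeff i * 1_{(lo i, hi i]}(u)`. -/
def StepFun.eval (φ : StepFun) (u : ℝ) : ℝ :=
  ∑ i, (Set.Ioc (φ.lo i) (φ.hi i)).indicator (fun _ => φ.coeff i) u

/-- The integral `∑ i, coeff i * (W (hi i) - W (lo i))` of a step function against `W`. -/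
def StepFun.integral {Ω : Type*} (φ : StepFun) (W : ℝ → Ω → ℝ) (ω : Ω) : ℝ :=
  ∑ i, φ.coeff i * (W (φ.hi i) ω - W (φ.lo i) ω)

/-- `X = ∫ f(u) W(du)` almost surely: for `f ∈ L²(ℝ)` the Wiener integral is the `L²(P)`-limit of
the integrals of step functions that converge to `f` in `L²(ℝ)`. As for other integrals, the value
is `0` by convention if `f` is not square-integrable. -/
def IsWienerIntegral {Ω : Type*} [MeasurableSpace Ω] (P : Measure Ω) (W : ℝ → Ω → ℝ)
    (f : ℝ → ℝ) (X : Ω → ℝ) : Prop :=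
  (MemLp f 2 volume ∧ ∃ φ : ℕ → StepFun,
    Tendsto (fun k => eLpNorm (fun u => (φ k).eval u - f u) 2 volume) atTop (𝓝 0) ∧
    Tendsto (fun k => eLpNorm (fun ω => (φ k).integral W ω - X ω) 2 P) atTop (𝓝 0)) ∨
  (¬ MemLp f 2 volume ∧ ∀ᵐ ω ∂P, X ω = 0)

/-! ### The Fourier transform of white noise -/

/-- The `L²`-Fourier transform of a real-valued square-integrable function. -/
def fourierL2 (e : Lp ℝ 2 (volume : Measure ℝ)) : Lp ℂ 2 (volume : Measure ℝ) :=
  𝓕 (Complex.ofRealCLM.compLp e)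

/-- `X = ∫ f(ξ) Ŵ(dξ)` almost surely, where `Ŵ = ∑ n, η n • 𝓕 (e n)` is the Fourier transform of
the white noise `∑ n, η n • e n`; here `(e n)` is an orthonormal basis of `L²(ℝ)` and
`(η n)` are independent standard Gaussian variables. For `f ∈ L²(ℝ; ℂ)` the integral is
`∑ n, η n * ∫ f(ξ) (𝓕 (e n))(ξ) dξ`, with convergence in `L²(P)`. By convention it is `0` if `f` is
not square-integrable. (The unitary normalizations `∫ exp(-2πixξ) e(x) dx` and
`(2π)^(-1/2) ∫ exp(-ixξ) e(x) dx` differ by a dilation of the orthonormal basis only.) -/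
def IsHarmonizableIntegral {Ω : Type*} [MeasurableSpace Ω] (P : Measure Ω)
    (e : HilbertBasis ℕ ℝ (Lp ℝ 2 (volume : Measure ℝ))) (η : ℕ → Ω → ℝ)
    (f : ℝ → ℂ) (X : Ω → ℝ) : Prop :=
  (MemLp f 2 volume ∧
    Tendsto (fun N => eLpNorm (fun ω =>
      (∑ n ∈ Finset.range N, (η n ω : ℂ) * ∫ ξ, f ξ * fourierL2 (e n) ξ) - (X ω : ℂ)) 2 P)
      atTop (𝓝 0)) ∨
  (¬ MemLp f 2 volume ∧ ∀ᵐ ω ∂P, X ω = 0)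

/-! ### Multifractional Brownian motion -/

/-- `Γ(h + 1/2)⁻¹ ((t-u)₊^(h-1/2) - (-u)₊^(h-1/2))`, where the truncated powers vanish for
`u ≥ t` and `u ≥ 0`, respectively. -/
def movingAverageKernel (h t u : ℝ) : ℝ :=
  1 / Real.Gamma (h + 1 / 2) *
    ((if u < t then (t - u) ^ (h - 1 / 2) else 0) - (if u < 0 then (-u) ^ (h - 1 / 2) else 0))

/-- `(exp(i t ξ) - 1) / |ξ|^(h+1/2)`. -/
def harmonizableKernel (h t ξ : ℝ) : ℂ :=
  (Complex.exp (Complex.I * t * ξ) - 1) / ((|ξ| ^ (h + 1 / 2) : ℝ) : ℂ)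

/-- `B` is the mBm with Hurst function `H` in the moving average representation. -/
def IsMovingAverageMBm {Ω : Type*} [MeasurableSpace Ω] (P : Measure Ω) (H : ℝ≥0 → ℝ)
    (B : ℝ≥0 → Ω → ℝ) : Prop :=
  ∃ W : ℝ → Ω → ℝ, IsTwoSidedBrownian P W ∧
    ∀ t : ℝ≥0, IsWienerIntegral P W (movingAverageKernel (H t) t) (B t)

/-- `B` is the mBm with Hurst function `H` in the harmonizable representation. -/
def IsHarmonizableMBm {Ω : Type*} [MeasurableSpace Ω] (P : Measure Ω) (H : ℝ≥0 → ℝ)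
    (B : ℝ≥0 → Ω → ℝ) : Prop :=
  ∃ (e : HilbertBasis ℕ ℝ (Lp ℝ 2 (volume : Measure ℝ))) (η : ℕ → Ω → ℝ),
    iIndepFun η P ∧ (∀ n, HasLaw (η n) (gaussianReal 0 1) P) ∧
    ∀ t : ℝ≥0, IsHarmonizableIntegral P e η (harmonizableKernel (H t) t) (B t)

/-- Condition `(H_β)`: `H` is `β`-Hölder continuous and `sup_{s ≥ 0} H(s) < β`. -/
def HurstCondition (β : ℝ≥0) (H : ℝ≥0 → ℝ) : Prop :=
  (∃ C : ℝ≥0, HolderWith C β H) ∧ BddAbove (Set.range H) ∧ (⨆ s, H s) < β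

/-! ### Local times -/

/-- Lebesgue measure `λ` on `[0, ∞)`. -/
def lebesgue : Measure ℝ≥0 :=
  Measure.comap ((↑) : ℝ≥0 → ℝ) volume

/-- The occupation measure `A ↦ λ {s ∈ I : x s ∈ A}` of a path `x`. -/
def occupationMeasure (x : ℝ≥0 → ℝ) (I : Set ℝ≥0) : Measure ℝ :=
  (lebesgue.restrict I).map x

/-- The local time `L(I, ·)`: the density of the occupation measure. -/
def localTime (x : ℝ≥0 → ℝ) (I : Set ℝ≥0) : ℝ → ℝ≥0∞ :=
  (occupationMeasure x I).rnDeriv volume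

/-- Almost surely, the occupation measure of `B` on `I` is absolutely continuous with respect to
Lebesgue measure and `L(I, ·) ∈ L²(ℝ)`. -/
def HasSquareIntegrableLocalTime {Ω : Type*} [MeasurableSpace Ω] (P : Measure Ω)
    (B : ℝ≥0 → Ω → ℝ) (I : Set ℝ≥0) : Prop :=
  ∀ᵐ ω ∂P, occupationMeasure (fun s => B s ω) I ≪ volume ∧
    ∫⁻ x, localTime (fun s => B s ω) I x ^ 2 < ∞

end MBm

end

namespace MBm

/-! ### Measures on the line whose mollifications are bounded in `L²` -/

theorem lintegral_rnDeriv_sq_le_liminf (m : Measure ℝ) [IsFiniteMeasure m] {r : ℕ → ℝ}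
    (hr : ∀ k, 0 < r k) (hr0 : Tendsto r atTop (𝓝 0)) :
    ∫⁻ x, m.rnDeriv volume x ^ 2 ≤
      liminf (fun k => ∫⁻ x, (m (Metric.closedBall x (r k)) /
        volume (Metric.closedBall x (r k))) ^ 2) atTop := by
  have hr' : Tendsto r atTop (𝓝[>] 0) :=
    tendsto_nhdsWithin_iff.2 ⟨hr0, Eventually.of_forall hr⟩
  have hmeas : ∀ k, Measurable fun x => (m (Metric.closedBall x (r k)) /
      volume (Metric.closedBall x (r k))) ^ 2 := fun k => by
    have h1 : MeasurableSet {p : ℝ × ℝ | p.2 ∈ Metric.closedBall p.1 (r k)} := by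
      simp only [Metric.mem_closedBall]
      exact measurableSet_le (by fun_prop) (by fun_prop)
    have h2 : Measurable fun x => m (Metric.closedBall x (r k)) :=
      measurable_measure_prodMk_left (ν := m) h1
    simp only [Real.volume_closedBall]
    exact (h2.div_const _).pow_const 2
  refine le_trans (le_of_eq ?_) (lintegral_liminf_le hmeas)
  refine lintegral_congr_ae ?_
  filter_upwards [Besicovitch.ae_tendsto_rnDeriv m volume] with x hx
  exact (((ENNReal.continuous_pow 2).tendsto _).comp (hx.comp hr')).liminf_eq.symm

theorem measure_isOpen_le_liminf (m : Measure ℝ) [IsFiniteMeasure m] {r : ℕ → ℝ}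
    (hr : ∀ k, 0 < r k) (hr0 : Tendsto r atTop (𝓝 0)) {U : Set ℝ} (hU : IsOpen U) :
    m U ≤ liminf (fun k => ∫⁻ x in U, m (Metric.closedBall x (r k)) /
        volume (Metric.closedBall x (r k))) atTop := by
  have hball : ∀ k, MeasurableSet {p : ℝ × ℝ | p.2 ∈ Metric.closedBall p.1 (r k)} := fun k => by
    simp only [Metric.mem_closedBall]
    exact measurableSet_le (by fun_prop) (by fun_prop)
  have hmeas : ∀ k, Measurable fun y =>
      volume.restrict U (Metric.closedBall y (r k)) / ENNReal.ofReal (2 * r k) := fun k =>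
    (measurable_measure_prodMk_left (ν := volume.restrict U) (hball k)).div_const _
  have hswap : ∀ k, ∫⁻ x in U, m (Metric.closedBall x (r k)) /
        volume (Metric.closedBall x (r k)) =
      ∫⁻ y, volume.restrict U (Metric.closedBall y (r k)) / ENNReal.ofReal (2 * r k) ∂m := by
    intro k
    simp only [Real.volume_closedBall, div_eq_mul_inv]
    have m1 : Measurable fun x => m (Metric.closedBall x (r k)) :=
      measurable_measure_prodMk_left (ν := m) (hball k)
    have m2 : Measurable fun x => volume.restrict U (Metric.closedBall x (r k)) :=
      measurable_measure_prodMk_left (ν := volume.restrict U) (hball k)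
    rw [lintegral_mul_const _ m1, lintegral_mul_const _ m2]
    congr 1
    have e1 := Measure.prod_apply (μ := volume.restrict U) (ν := m) (hball k)
    have e2 := Measure.prod_apply_symm (μ := volume.restrict U) (ν := m) (hball k)
    refine (e1.symm.trans e2).trans (lintegral_congr fun y => ?_)
    congr 1
    ext x
    simp [dist_comm]
  simp only [hswap]
  refine le_trans ?_ (lintegral_liminf_le hmeas)
  rw [← lintegral_indicator_one hU.measurableSet]
  refine lintegral_mono fun y => ?_
  by_cases hy : y ∈ U
  · simp only [hy, Set.indicator_of_mem, Pi.one_apply]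
    obtain ⟨δ, hδ, hsub⟩ := Metric.isOpen_iff.1 hU y hy
    refine le_liminf_of_le (by isBoundedDefault) ?_
    filter_upwards [hr0.eventually (gt_mem_nhds hδ)] with k hk
    rw [Measure.restrict_apply measurableSet_closedBall, Set.inter_eq_left.2
      ((Metric.closedBall_subset_ball hk).trans hsub), Real.volume_closedBall, ENNReal.div_self]
    · simpa using hr k
    · exact ENNReal.ofReal_ne_top
  · simp [hy]

theorem absolutelyContinuous_of_liminf_lt_top (m : Measure ℝ) [IsFiniteMeasure m] {r : ℕ → ℝ}
    (hr : ∀ k, 0 < r k) (hr0 : Tendsto r atTop (𝓝 0))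
    (h : liminf (fun k => ∫⁻ x, (m (Metric.closedBall x (r k)) /
        volume (Metric.closedBall x (r k))) ^ 2) atTop < ∞) :
    m ≪ volume := by
  obtain ⟨C, hC, hCtop⟩ := exists_between h
  have hfreq := frequently_lt_of_liminf_lt (by isBoundedDefault) hC
  have key : ∀ U : Set ℝ, IsOpen U → m U ≤ C ^ (1 / 2 : ℝ) * volume U ^ (1 / 2 : ℝ) := by
    intro U hU
    refine (measure_isOpen_le_liminf m hr hr0 hU).trans
      (liminf_le_of_frequently_le' (hfreq.mono fun k hk => ?_))
    have hmeas : Measurable fun x => m (Metric.closedBall x (r k)) /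
        volume (Metric.closedBall x (r k)) := by
      have h1 : MeasurableSet {p : ℝ × ℝ | p.2 ∈ Metric.closedBall p.1 (r k)} := by
        simp only [Metric.mem_closedBall]
        exact measurableSet_le (by fun_prop) (by fun_prop)
      have h2 : Measurable fun x => m (Metric.closedBall x (r k)) :=
        measurable_measure_prodMk_left (ν := m) h1
      simp only [Real.volume_closedBall]
      exact h2.div_const _
    have := ENNReal.lintegral_mul_le_Lp_mul_Lq (volume.restrict U)
      (Real.HolderConjugate.two_two) hmeas.aemeasurable
      (aemeasurable_const (b := (1 : ℝ≥0∞)))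
    simp only [Pi.mul_apply, mul_one, lintegral_const, one_mul, one_pow,
      Measure.restrict_apply_univ, ENNReal.rpow_two] at this
    refine this.trans ?_
    gcongr
    exact (setLIntegral_le_lintegral _ _).trans hk.le
  refine Measure.AbsolutelyContinuous.mk fun s _ hs0 => ?_
  have hlim : Tendsto (fun n : ℕ => C ^ (1 / 2 : ℝ) * ((n : ℝ≥0∞)⁻¹) ^ (1 / 2 : ℝ)) atTop
      (𝓝 (C ^ (1 / 2 : ℝ) * (0 : ℝ≥0∞) ^ (1 / 2 : ℝ))) :=
    ENNReal.Tendsto.const_mul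
      ((ENNReal.continuous_rpow_const.tendsto _).comp ENNReal.tendsto_inv_nat_nhds_zero)
      (Or.inr (ENNReal.rpow_ne_top_of_nonneg (by norm_num) hCtop.ne))
  rw [ENNReal.zero_rpow_of_pos (by norm_num), mul_zero] at hlim
  refine le_antisymm (ge_of_tendsto' hlim fun n => ?_) zero_le
  obtain ⟨U, hsU, hU, hUv⟩ := Set.exists_isOpen_lt_of_lt s ((n : ℝ≥0∞)⁻¹)
    (by rw [hs0]; simp)
  refine (measure_mono hsU).trans ((key U hU).trans ?_)
  gcongr

theorem lintegral_closedBall_ratio_sq_le (m : Measure ℝ) [IsFiniteMeasure m] {r : ℝ}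
    (hr : 0 < r) :
    ∫⁻ x, (m (Metric.closedBall x r) / volume (Metric.closedBall x r)) ^ 2 ≤
      (ENNReal.ofReal (2 * r))⁻¹ * ∫⁻ y, m (Metric.closedBall y (2 * r)) ∂m := by
  set c := ENNReal.ofReal (2 * r) with hc
  have hc0 : c ≠ 0 := by simp [hc, hr]
  have hct : c ≠ ∞ := ENNReal.ofReal_ne_top
  have hball : ∀ r : ℝ, MeasurableSet {p : ℝ × ℝ | p.2 ∈ Metric.closedBall p.1 r} := fun r => by
    simp only [Metric.mem_closedBall]
    exact measurableSet_le (by fun_prop) (by fun_prop)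
  have hm : ∀ r : ℝ, Measurable fun x => m (Metric.closedBall x r) := fun r =>
    measurable_measure_prodMk_left (ν := m) (hball r)
  have step : ∫⁻ x, m (Metric.closedBall x r) ^ 2 ≤
      c * ∫⁻ y, m (Metric.closedBall y (2 * r)) ∂m := by
    calc ∫⁻ x, m (Metric.closedBall x r) ^ 2
        ≤ ∫⁻ x, ∫⁻ y, {p : ℝ × ℝ | p.2 ∈ Metric.closedBall p.1 r}.indicator
            (fun p => m (Metric.closedBall p.2 (2 * r))) (x, y) ∂m := by
          refine lintegral_mono fun x => ?_
          have : ∀ y, {p : ℝ × ℝ | p.2 ∈ Metric.closedBall p.1 r}.indicator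
            (fun p => m (Metric.closedBall p.2 (2 * r))) (x, y) =
            (Metric.closedBall x r).indicator (fun y => m (Metric.closedBall y (2 * r))) y :=
            fun y => by simp [Set.indicator]
          simp only [this]
          rw [lintegral_indicator measurableSet_closedBall, sq,
            ← setLIntegral_const]
          refine setLIntegral_mono (hm _) fun y hy => measure_mono fun z hz => ?_
          simp only [Metric.mem_closedBall] at *
          linarith [dist_triangle_right z y x]
      _ = ∫⁻ y, ∫⁻ x, {p : ℝ × ℝ | p.2 ∈ Metric.closedBall p.1 r}.indicator
            (fun p => m (Metric.closedBall p.2 (2 * r))) (x, y) ∂volume ∂m := by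
          refine lintegral_lintegral_swap (Measurable.aemeasurable ?_)
          exact ((hm (2 * r)).comp measurable_snd).indicator (hball r)
      _ = ∫⁻ y, c * m (Metric.closedBall y (2 * r)) ∂m := by
          refine lintegral_congr fun y => ?_
          have : ∀ x, {p : ℝ × ℝ | p.2 ∈ Metric.closedBall p.1 r}.indicator
            (fun p => m (Metric.closedBall p.2 (2 * r))) (x, y) =
            (Metric.closedBall y r).indicator (fun _ => m (Metric.closedBall y (2 * r))) x :=
            fun x => by simp [Set.indicator, dist_comm]
          simp only [this]
          rw [lintegral_indicator measurableSet_closedBall, setLIntegral_const,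
            Real.volume_closedBall, mul_comm]
      _ = _ := lintegral_const_mul _ (hm _)
  simp only [Real.volume_closedBall, ← hc, div_eq_mul_inv, mul_pow]
  rw [lintegral_mul_const _ ((hm r).pow_const 2)]
  calc _ ≤ (c * ∫⁻ y, m (Metric.closedBall y (2 * r)) ∂m) * c⁻¹ ^ 2 := by gcongr
    _ = (c * c⁻¹) * (c⁻¹ * ∫⁻ y, m (Metric.closedBall y (2 * r)) ∂m) := by ring
    _ = _ := by rw [ENNReal.mul_inv_cancel hc0 hct, one_mul]

/-! ### Small ball probabilities of Wiener integrals -/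

section SmallBall

variable {Ω : Type*} [MeasurableSpace Ω] {P : Measure Ω} {W : ℝ → Ω → ℝ}

theorem IsTwoSidedBrownian.isPreBrownianReal_shift (hW : IsTwoSidedBrownian P W) (M : ℝ) :
    IsPreBrownianReal (fun (s : ℝ≥0) ω => W (s - M) ω - W (-M) ω) P := by
  refine HasIndepIncrements.isPreBrownianReal_of_hasLaw (fun t => ?_) fun n t ht => ?_
  · have := hW.law (-M) (t - M) (by linarith [t.2])
    simpa using this
  · have := hW.indep n (fun i => (t i : ℝ) - M) fun i j hij => by
      have : (t i : ℝ) ≤ t j := ht hij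
      linarith
    simpa using this

theorem min_sub_min_add_min_eq {a b c d : ℝ} (hab : a ≤ b) (hcd : c ≤ d) :
    min b d - min b c - min a d + min a c = max 0 (min b d - max a c) := by
  grind

theorem IsTwoSidedBrownian.hasLaw_sum (hW : IsTwoSidedBrownian P W) {ι : Type*} [Fintype ι]
    (c a b : ι → ℝ) (hab : ∀ i, a i ≤ b i) :
    ∃ v : ℝ≥0, HasLaw (fun ω => ∑ i, c i * (W (b i) ω - W (a i) ω)) (gaussianReal 0 v) P ∧
      (v : ℝ) = ∫ u, (∑ i, (Set.Ioc (a i) (b i)).indicator (fun _ => c i) u) ^ 2 := by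
  obtain ⟨M, hM⟩ : ∃ M : ℝ, ∀ i, 0 ≤ a i + M := by
    refine ⟨∑ i, |a i|, fun i => ?_⟩
    have := Finset.single_le_sum (f := fun i => |a i|) (fun i _ => abs_nonneg _)
      (Finset.mem_univ i)
    have h2 := neg_abs_le (a i)
    linarith
  have hMb : ∀ i, 0 ≤ b i + M := fun i => by linarith [hM i, hab i]
  have hX := hW.isPreBrownianReal_shift M
  set X : ℝ≥0 → Ω → ℝ := fun (s : ℝ≥0) ω => W (s - M) ω - W (-M) ω with hXdef
  have := hX.isGaussianProcess.isProbabilityMeasure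
  let a' : ι → ℝ≥0 := fun i => ⟨a i + M, hM i⟩
  let b' : ι → ℝ≥0 := fun i => ⟨b i + M, hMb i⟩
  have hL : ∀ s, MemLp (X s) 2 P := fun s => (hX.isGaussianProcess.hasGaussianLaw_eval s).memLp_two
  have hsum : (fun ω => ∑ i, c i * (W (b i) ω - W (a i) ω)) =
      ∑ i, c i • (X (b' i) - X (a' i)) := by
    ext ω
    have e1 : ∀ i, ((b' i : ℝ) - M) = b i := fun i => by change b i + M - M = b i; ring
    have e2 : ∀ i, ((a' i : ℝ) - M) = a i := fun i => by change a i + M - M = a i; ring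
    simp [X, e1, e2]
  let D : ι → Ω → ℝ := fun i => c i • (X (b' i) - X (a' i))
  have hDL : ∀ i, MemLp (D i) 2 P := fun i => ((hL _).sub (hL _)).const_smul _
  have hg : HasGaussianLaw (∑ i, D i) P := by
    classical
    have hY := hX.isGaussianProcess.of_isGaussianProcess (S := Unit) (Y := fun _ => ∑ i, D i)
      (fun _ => ⟨Finset.univ.image a' ∪ Finset.univ.image b',
        ∑ i, c i • (ContinuousLinearMap.proj (R := ℝ) (φ := fun _ => ℝ)
            (⟨b' i, by simp⟩ : (Finset.univ.image a' ∪ Finset.univ.image b' : Finset ℝ≥0)) -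
          ContinuousLinearMap.proj (R := ℝ) (φ := fun _ => ℝ)
            (⟨a' i, by simp⟩ : (Finset.univ.image a' ∪ Finset.univ.image b' : Finset ℝ≥0))),
        fun ω => by simp [D]⟩)
    exact hY.hasGaussianLaw_eval ()
  have hmean : P[∑ i, D i] = 0 := by
    simp only [Finset.sum_apply]
    rw [integral_finsetSum _ fun i _ => (hDL i).integrable (by norm_num)]
    refine Finset.sum_eq_zero fun i _ => ?_
    simp only [D, Pi.smul_apply, Pi.sub_apply]
    rw [integral_smul, integral_sub (hX.integrable_eval _) (hX.integrable_eval _),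
      hX.integral_eval, hX.integral_eval]
    simp
  have hcov : ∀ i j, cov[D i, D j; P] =
      c i * c j * max 0 (min (b i) (b j) - max (a i) (a j)) := by
    intro i j
    simp only [D]
    rw [covariance_smul_left, covariance_smul_right, covariance_sub_left (hL _) (hL _)
      ((hL _).sub (hL _)), covariance_sub_right (hL _) (hL _) (hL _),
      covariance_sub_right (hL _) (hL _) (hL _)]
    have e1 : ∀ i, (b' i : ℝ) = b i + M := fun _ => rfl
    have e2 : ∀ i, (a' i : ℝ) = a i + M := fun _ => rfl
    have hc : ∀ s t, cov[X s, X t; P] = min (s : ℝ) t := fun s t => by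
      rw [hX.covariance_eval, NNReal.coe_min]
    simp only [hc, e1, e2, min_add_add_right]
    rw [← min_sub_min_add_min_eq (hab i) (hab j)]
    ring
  have hvar : Var[∑ i, D i; P] =
      ∫ u, (∑ i, (Set.Ioc (a i) (b i)).indicator (fun _ => c i) u) ^ 2 := by
    rw [variance_sum hDL]
    simp only [hcov]
    have h1 : ∀ u, (∑ i, (Set.Ioc (a i) (b i)).indicator (fun _ => c i) u) ^ 2 =
        ∑ i, ∑ j, (Set.Ioc (max (a i) (a j)) (min (b i) (b j))).indicator
          (fun _ => c i * c j) u := by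
      intro u
      rw [sq, Finset.sum_mul_sum]
      refine Finset.sum_congr rfl fun i _ => Finset.sum_congr rfl fun j _ => ?_
      rw [← Set.Ioc_inter_Ioc, Set.inter_indicator_mul]
    have hint : ∀ i j, Integrable ((Set.Ioc (max (a i) (a j)) (min (b i) (b j))).indicator
          (fun _ => c i * c j)) := fun i j =>
      (integrable_indicator_iff measurableSet_Ioc).2 (integrableOn_const (by simp))
    simp only [h1]
    rw [integral_finsetSum _ fun i _ => integrable_finsetSum _ fun j _ => hint i j]
    refine Finset.sum_congr rfl fun i _ => ?_
    rw [integral_finsetSum _ fun j _ => hint i j]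
    refine Finset.sum_congr rfl fun j _ => ?_
    rw [integral_indicator measurableSet_Ioc, setIntegral_const, measureReal_def,
      Real.volume_Ioc, smul_eq_mul, ENNReal.toReal_ofReal', max_comm]
    ring
  refine ⟨Var[∑ i, D i; P].toNNReal, ?_, ?_⟩
  · rw [hsum]
    exact ⟨hg.aemeasurable, by rw [hg.map_eq_gaussianReal, hmean]⟩
  · rw [Real.coe_toNNReal _ (variance_nonneg _ _), hvar]

theorem gaussianReal_closedBall_le {v : ℝ≥0} (hv : v ≠ 0) (r : ℝ) :
    gaussianReal 0 v {x | |x| ≤ r} ≤ ENNReal.ofReal (r / √v) := by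
  have hv0 : (0 : ℝ) < v := by positivity
  rw [gaussianReal_apply 0 hv]
  have hset : {x : ℝ | |x| ≤ r} = Set.Icc (-r) r := by ext x; simp [abs_le]
  have hle : ∀ x, gaussianPDF 0 v x ≤ ENNReal.ofReal ((2 * √v)⁻¹) := by
    intro x
    refine ENNReal.ofReal_le_ofReal ?_
    rw [gaussianPDFReal]
    have h1 : Real.exp (-(x - 0) ^ 2 / (2 * v)) ≤ 1 := by
      rw [Real.exp_le_one_iff]
      exact div_nonpos_of_nonpos_of_nonneg (by nlinarith [sq_nonneg (x - 0)]) (by positivity)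
    have h2 : 2 * √(v : ℝ) ≤ √(2 * Real.pi * v) := by
      refine Real.le_sqrt_of_sq_le ?_
      rw [mul_pow, Real.sq_sqrt hv0.le]
      nlinarith [Real.pi_gt_three]
    calc _ ≤ (√(2 * Real.pi * v))⁻¹ * 1 := by gcongr
      _ ≤ _ := by rw [mul_one]; gcongr
  calc _ ≤ ∫⁻ _ in {x : ℝ | |x| ≤ r}, ENNReal.ofReal ((2 * √v)⁻¹) :=
        lintegral_mono fun x => hle x
    _ = _ := by
      rw [setLIntegral_const, hset, Real.volume_Icc, ← ENNReal.ofReal_mul (by positivity)]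
      congr 1
      field_simp
      ring

theorem IsTwoSidedBrownian.measure_abs_le (hW : IsTwoSidedBrownian P W) {ι : Type*} [Fintype ι]
    (c a b : ι → ℝ) (hab : ∀ i, a i ≤ b i) (r : ℝ)
    (hpos : 0 < ∫ u, (∑ i, (Set.Ioc (a i) (b i)).indicator (fun _ => c i) u) ^ 2) :
    P {ω | |∑ i, c i * (W (b i) ω - W (a i) ω)| ≤ r} ≤ ENNReal.ofReal
      (r / √(∫ u, (∑ i, (Set.Ioc (a i) (b i)).indicator (fun _ => c i) u) ^ 2)) := by
  obtain ⟨v, hlaw, hv⟩ := hW.hasLaw_sum c a b hab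
  rw [← hv] at hpos ⊢
  have hv0 : v ≠ 0 := by rintro rfl; simp at hpos
  refine le_trans (le_of_eq ?_) (gaussianReal_closedBall_le hv0 r)
  rw [← hlaw.map_eq, Measure.map_apply_of_aemeasurable hlaw.aemeasurable
      (measurableSet_le (by fun_prop) (by fun_prop))]
  rfl

theorem IsWienerIntegral.measure_abs_sub_le [IsProbabilityMeasure P]
    (hW : IsTwoSidedBrownian P W) {f g : ℝ → ℝ} (hf : MemLp f 2) (hg : MemLp g 2)
    {X Y : Ω → ℝ} (hX : Measurable X) (hY : Measurable Y)
    (hfX : IsWienerIntegral P W f X) (hgY : IsWienerIntegral P W g Y)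
    {r : ℝ} (hr : 0 < r) {σ : ℝ} (hσ : 0 < σ)
    (hσfg : ENNReal.ofReal σ ≤ eLpNorm (fun u => f u - g u) 2 volume) :
    P {ω | |X ω - Y ω| ≤ r} ≤ ENNReal.ofReal (4 * r / σ) := by
  obtain ⟨_, φ, hφ, hφX⟩ := hfX.resolve_right fun h => h.1 hf
  obtain ⟨_, ψ, hψ, hψY⟩ := hgY.resolve_right fun h => h.1 hg
  -- the difference of the two step functions as a single sum over intervals
  let c k : Fin (φ k).n ⊕ Fin (ψ k).n → ℝ := Sum.elim (φ k).coeff fun i => -(ψ k).coeff i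
  let a k : Fin (φ k).n ⊕ Fin (ψ k).n → ℝ := Sum.elim (φ k).lo (ψ k).lo
  let b k : Fin (φ k).n ⊕ Fin (ψ k).n → ℝ := Sum.elim (φ k).hi (ψ k).hi
  have hab : ∀ k i, a k i ≤ b k i := by
    rintro k (i | i)
    · exact (φ k).le i
    · exact (ψ k).le i
  have heval : ∀ k u, ∑ i, (Set.Ioc (a k i) (b k i)).indicator (fun _ => c k i) u =
      (φ k).eval u - (ψ k).eval u := by
    intro k u
    simp only [Fintype.sum_sum_type, a, b, c, Sum.elim_inl, Sum.elim_inr, StepFun.eval,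
      Set.indicator_neg]
    rw [Finset.sum_neg_distrib, sub_eq_add_neg]
  have hint : ∀ k ω, ∑ i, c k i * (W (b k i) ω - W (a k i) ω) =
      (φ k).integral W ω - (ψ k).integral W ω := by
    intro k ω
    simp only [Fintype.sum_sum_type, a, b, c, Sum.elim_inl, Sum.elim_inr, StepFun.integral,
      neg_mul, Finset.sum_neg_distrib, sub_eq_add_neg]
  have hWm : ∀ k, AEStronglyMeasurable (fun ω => (φ k).integral W ω - (ψ k).integral W ω) P := by
    intro k
    obtain ⟨v, hv, -⟩ := hW.hasLaw_sum (c k) (a k) (b k) (hab k)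
    simp only [hint] at hv
    exact hv.aemeasurable.aestronglyMeasurable
  have hφm : ∀ θ : StepFun, AEStronglyMeasurable (fun ω => θ.integral W ω) P := fun θ => by
    obtain ⟨v, hv, -⟩ := hW.hasLaw_sum θ.coeff θ.lo θ.hi θ.le
    exact hv.aemeasurable.aestronglyMeasurable
  have hem : ∀ θ : StepFun, MemLp θ.eval 2 := fun θ => by
    refine memLp_finsetSum (f := fun i => (Set.Ioc (θ.lo i) (θ.hi i)).indicator
      fun _ => θ.coeff i) _ fun i _ => ?_
    exact memLp_indicator_const 2 measurableSet_Ioc _ (Or.inr (by simp))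
  have hdX : Tendsto (fun k => eLpNorm ((fun ω => (φ k).integral W ω - (ψ k).integral W ω) -
      fun ω => X ω - Y ω) 2 P) atTop (𝓝 0) := by
    have h0 : Tendsto (fun k => eLpNorm (fun ω => (φ k).integral W ω - X ω) 2 P +
      eLpNorm (fun ω => (ψ k).integral W ω - Y ω) 2 P) atTop (𝓝 0) := by
      simpa using hφX.add hψY
    refine tendsto_of_tendsto_of_tendsto_of_le_of_le tendsto_const_nhds h0
      (fun _ => zero_le) fun k => ?_
    refine le_trans (le_of_eq ?_) (eLpNorm_sub_le ((hφm _).sub hX.aestronglyMeasurable)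
      ((hφm _).sub hY.aestronglyMeasurable) (by norm_num))
    congr 1
    ext ω
    simp only [Pi.sub_apply]
    ring
  have hmeas := tendstoInMeasure_of_tendsto_eLpNorm (by norm_num) hWm
    (hX.sub hY).aestronglyMeasurable hdX
  have hnorm : Tendsto (fun k => ENNReal.ofReal σ - (eLpNorm (fun u => (φ k).eval u - f u) 2 volume
      + eLpNorm (fun u => (ψ k).eval u - g u) 2 volume)) atTop (𝓝 (ENNReal.ofReal σ - (0 + 0))) :=
    ENNReal.Tendsto.sub tendsto_const_nhds (hφ.add hψ) (Or.inl (by simp))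
  have hlow : ∀ k, ENNReal.ofReal σ - (eLpNorm (fun u => (φ k).eval u - f u) 2 volume
      + eLpNorm (fun u => (ψ k).eval u - g u) 2 volume) ≤
      eLpNorm (fun u => (φ k).eval u - (ψ k).eval u) 2 volume := by
    intro k
    rw [tsub_le_iff_right]
    refine hσfg.trans ?_
    have e : (fun u => f u - g u) = (fun u => (φ k).eval u - (ψ k).eval u) -
        ((fun u => (φ k).eval u - f u) - fun u => (ψ k).eval u - g u) := by
      ext u; simp only [Pi.sub_apply]; ring
    rw [e]
    have m1 := ((hem (φ k)).sub hf).aestronglyMeasurable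
    have m2 := ((hem (ψ k)).sub hg).aestronglyMeasurable
    refine (eLpNorm_sub_le ((hem (φ k)).sub (hem (ψ k))).aestronglyMeasurable
      (m1.sub m2) (by norm_num)).trans ?_
    exact add_le_add le_rfl (eLpNorm_sub_le m1 m2 (by norm_num))
  have hL2 : ∀ k, eLpNorm (fun u => (φ k).eval u - (ψ k).eval u) 2 volume = ENNReal.ofReal
      √(∫ u, (∑ i, (Set.Ioc (a k i) (b k i)).indicator (fun _ => c k i) u) ^ 2) := by
    intro k
    simp only [heval]
    have hsub : MemLp (fun u => (φ k).eval u - (ψ k).eval u) 2 := (hem (φ k)).sub (hem (ψ k))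
    rw [hsub.eLpNorm_eq_integral_rpow_norm (by norm_num) (by norm_num)]
    simp [Real.sqrt_eq_rpow]
  have hstep : ∀ᶠ k in atTop, P {ω | |X ω - Y ω| ≤ r} ≤ ENNReal.ofReal (4 * r / σ) +
      P {ω | ENNReal.ofReal (r / 4) ≤ edist ((φ k).integral W ω - (ψ k).integral W ω) (X ω - Y ω)} := by
    have hlt : ENNReal.ofReal (σ / 2) < ENNReal.ofReal σ - (0 + 0) := by
      rw [add_zero, tsub_zero]
      exact (ENNReal.ofReal_lt_ofReal_iff hσ).2 (by linarith)
    filter_upwards [hnorm.eventually (lt_mem_nhds hlt)] with k hk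
    have hk' := (hk.trans_le (hlow k)).le
    rw [hL2, ENNReal.ofReal_le_ofReal_iff (Real.sqrt_nonneg _)] at hk'
    have hpos : 0 < ∫ u, (∑ i, (Set.Ioc (a k i) (b k i)).indicator (fun _ => c k i) u) ^ 2 :=
      Real.sqrt_pos.1 (by linarith)
    have hG := hW.measure_abs_le (c k) (a k) (b k) (hab k) (2 * r) hpos
    simp only [hint] at hG
    refine (measure_mono (t := {ω | |(φ k).integral W ω - (ψ k).integral W ω| ≤ 2 * r} ∪ {ω |
      ENNReal.ofReal (r / 4) ≤ edist ((φ k).integral W ω - (ψ k).integral W ω) (X ω - Y ω)})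
      fun ω hω => ?_).trans ((measure_union_le _ _).trans ?_)
    · by_contra hcon
      simp only [Set.mem_union, Set.mem_ofPred_eq, not_or, not_le, edist_dist] at hcon hω
      have h2 := (ENNReal.ofReal_lt_ofReal_iff (by positivity)).1 hcon.2
      rw [Real.dist_eq] at h2
      have h3 := abs_sub_abs_le_abs_sub ((φ k).integral W ω - (ψ k).integral W ω) (X ω - Y ω)
      linarith [hcon.1]
    · gcongr
      refine hG.trans (ENNReal.ofReal_le_ofReal ?_)
      rw [div_le_div_iff₀ (Real.sqrt_pos.2 hpos) hσ]
      nlinarith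
  have hlim : Tendsto (fun k => ENNReal.ofReal (4 * r / σ) +
      P {ω | ENNReal.ofReal (r / 4) ≤ edist ((φ k).integral W ω - (ψ k).integral W ω) (X ω - Y ω)})
      atTop (𝓝 (ENNReal.ofReal (4 * r / σ) + 0)) :=
    tendsto_const_nhds.add (hmeas _ (by simpa using hr))
  rw [add_zero] at hlim
  exact ge_of_tendsto hlim hstep

end SmallBall

/-! ### The moving average kernel -/

/-- The truncated power `y₊ ^ p`. -/
noncomputable def truncPow (p y : ℝ) : ℝ := if 0 < y then y ^ p else 0

theorem measurable_truncPow (p : ℝ) : Measurable (truncPow p) :=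
  Measurable.ite measurableSet_Ioi (by fun_prop) measurable_const

theorem integrableOn_truncPow {p : ℝ} (hp : -1 < p) (R : ℝ) :
    IntegrableOn (truncPow p) (Set.Iic R) := by
  have h1 : IntegrableOn (truncPow p) (Set.Iic 0) :=
    (integrableOn_zero (s := Set.Iic (0 : ℝ))).congr_fun
      (fun y hy => by simp [truncPow, not_lt.2 (Set.mem_Iic.1 hy)]) measurableSet_Iic
  have h2 : IntegrableOn (truncPow p) (Set.Ioc 0 (max 0 R)) := by
    have := (intervalIntegral.intervalIntegrable_rpow' (a := 0) (b := max 0 R) hp)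
    rw [intervalIntegrable_iff_integrableOn_Ioc_of_le (le_max_left _ _)] at this
    exact this.congr_fun (fun y hy => by simp [truncPow, hy.1]) measurableSet_Ioc
  refine (h1.union h2).mono_set fun y hy => ?_
  rcases le_or_gt y 0 with h | h
  · exact Or.inl h
  · exact Or.inr ⟨h, le_max_of_le_right hy⟩

theorem memLp_truncPow {p : ℝ} (hp : -(1 / 2) < p) (R : ℝ) :
    MemLp (truncPow p) 2 (volume.restrict (Set.Iic R)) := by
  rw [memLp_two_iff_integrable_sq (measurable_truncPow p).aestronglyMeasurable]
  have : (fun y => truncPow p y ^ 2) = truncPow (2 * p) := by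
    ext y
    unfold truncPow
    split_ifs with h
    · rw [← Real.rpow_natCast, ← Real.rpow_mul h.le, mul_comm]; norm_num
    · simp
  rw [this]
  exact integrableOn_truncPow (by linarith) R

theorem movingAverageKernel_eq (h t u : ℝ) :
    movingAverageKernel h t u = 1 / Real.Gamma (h + 1 / 2) *
      (truncPow (h - 1 / 2) (-u + t) - truncPow (h - 1 / 2) (-u)) := by
  unfold movingAverageKernel truncPow
  have h1 : 0 < -u + t ↔ u < t := by constructor <;> intro <;> linarith
  have h2 : -u + t = t - u := by ring
  simp only [h1, neg_pos]
  rw [h2]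

theorem abs_truncPow_add_sub_le {p t y : ℝ} (hp : p ≤ 1) (hp' : -1 ≤ p) (ht : 0 ≤ t)
    (hy : 0 < y) :
    |truncPow p (y + t) - truncPow p y| ≤ t * y ^ (p - 1) := by
  have hyt : 0 < y + t := by linarith
  simp only [truncPow, hy, hyt, if_true]
  have := (convex_Icc y (y + t)).norm_image_sub_le_of_norm_hasDerivWithin_le
    (f := fun x => x ^ p) (f' := fun x => p * x ^ (p - 1)) (C := y ^ (p - 1)) (x := y) (y := y + t)
    (fun x hx => (Real.hasDerivAt_rpow_const (Or.inl (by linarith [hx.1]))).hasDerivWithinAt)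
    (fun x hx => ?_) ⟨le_rfl, by linarith⟩ ⟨by linarith, le_rfl⟩
  · simpa [abs_of_nonneg ht, mul_comm] using this
  · have hx0 : 0 < x := hy.trans_le hx.1
    rw [norm_mul, Real.norm_eq_abs, Real.norm_of_nonneg (Real.rpow_nonneg hx0.le _)]
    calc |p| * x ^ (p - 1) ≤ 1 * y ^ (p - 1) :=
          mul_le_mul (abs_le.2 ⟨hp', hp⟩)
            (Real.rpow_le_rpow_of_nonpos hy hx.1 (by linarith)) (by positivity) zero_le_one
      _ = _ := one_mul _

theorem memLp_truncPow_add_sub {p t : ℝ} (hp : -(1 / 2) < p) (hp' : p < 1 / 2) (ht : 0 ≤ t) :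
    MemLp (fun y => truncPow p (y + t) - truncPow p y) 2 := by
  have hm : Measurable fun y => truncPow p (y + t) - truncPow p y :=
    ((measurable_truncPow p).comp (measurable_id.add_const t)).sub (measurable_truncPow p)
  have h1 : MemLp (fun y => truncPow p (y + t) - truncPow p y) 2
      (volume.restrict (Set.Iic 1)) := by
    refine MemLp.sub ?_ (memLp_truncPow hp 1)
    have hmp : MeasurePreserving (fun y : ℝ => y + t) (volume.restrict (Set.Iic 1))
        (volume.restrict (Set.Iic (1 + t))) := by
      have := (measurePreserving_add_right volume t).restrict_preimage
        (measurableSet_Iic (a := 1 + t))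
      simpa using this
    exact (memLp_truncPow hp (1 + t)).comp_measurePreserving hmp
  have h2 : MemLp (fun y => truncPow p (y + t) - truncPow p y) 2
      (volume.restrict (Set.Ioi 1)) := by
    have hb : MemLp (fun y : ℝ => t * y ^ (p - 1)) 2 (volume.restrict (Set.Ioi 1)) := by
      refine MemLp.const_mul ?_ t
      rw [memLp_two_iff_integrable_sq (by fun_prop)]
      refine (integrableOn_Ioi_rpow_of_lt (a := 2 * (p - 1)) (by linarith)
        (zero_lt_one)).congr_fun (fun y hy => ?_) measurableSet_Ioi
      have hy0 : (0 : ℝ) ≤ y := (zero_le_one.trans_lt hy).le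
      simp only
      rw [← Real.rpow_natCast, ← Real.rpow_mul hy0, mul_comm]
      norm_num
    refine hb.mono hm.aestronglyMeasurable ?_
    filter_upwards [ae_restrict_mem measurableSet_Ioi] with y hy
    rw [Real.norm_eq_abs]
    exact (abs_truncPow_add_sub_le (by linarith) (by linarith) ht
      (zero_lt_one.trans hy)).trans (le_abs_self _)
  rw [memLp_two_iff_integrable_sq hm.aestronglyMeasurable]
  have i1 := h1.integrable_sq
  have i2 := h2.integrable_sq
  rw [← integrableOn_univ, ← Set.Iic_union_Ioi (a := (1 : ℝ))]
  exact IntegrableOn.union i1 i2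

theorem memLp_movingAverageKernel {h t : ℝ} (h0 : 0 < h) (h1 : h < 1) (ht : 0 ≤ t) :
    MemLp (movingAverageKernel h t) 2 := by
  have := (memLp_truncPow_add_sub (p := h - 1 / 2) (by linarith) (by linarith) ht)
  have := this.comp_measurePreserving (Measure.measurePreserving_neg (volume : Measure ℝ))
  have := this.const_mul (1 / Real.Gamma (h + 1 / 2))
  refine this.congr_norm ?_ ?_
  · have hk : movingAverageKernel h t = fun u => 1 / Real.Gamma (h + 1 / 2) *
      (truncPow (h - 1 / 2) (-u + t) - truncPow (h - 1 / 2) (-u)) :=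
      funext (movingAverageKernel_eq h t)
    rw [hk]
    exact this.aestronglyMeasurable
  · exact Eventually.of_forall fun u => by
      simp [movingAverageKernel_eq]

theorem le_eLpNorm_movingAverageKernel_sub {h h' s t : ℝ} (h0 : 0 < h) (hs : 0 ≤ s) (hst : s < t) :
    ENNReal.ofReal ((t - s) ^ h / (√(2 * h) * Real.Gamma (h + 1 / 2))) ≤
      eLpNorm (fun u => movingAverageKernel h t u - movingAverageKernel h' s u) 2 volume := by
  have hΓ : 0 < Real.Gamma (h + 1 / 2) := Real.Gamma_pos_of_pos (by linarith)
  have hts : 0 < t - s := by linarith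
  have hnn : 0 ≤ (t - s) ^ h / (√(2 * h) * Real.Gamma (h + 1 / 2)) := by positivity
  have hint : ∫ u in s..t, (t - u) ^ (2 * h - 1) = (t - s) ^ (2 * h) / (2 * h) := by
    rw [intervalIntegral.integral_comp_sub_left (fun x => x ^ (2 * h - 1)) t, sub_self,
      integral_rpow (Or.inl (by linarith)), sub_add_cancel, Real.zero_rpow (by linarith), sub_zero]
  have hii : IntervalIntegrable (fun u => (t - u) ^ (2 * h - 1)) volume s t := by
    have := (intervalIntegral.intervalIntegrable_rpow' (a := 0) (b := t - s) (r := 2 * h - 1)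
      (by linarith)).comp_sub_left t
    simpa using this.symm
  have hsq : ((t - s) ^ h / (√(2 * h) * Real.Gamma (h + 1 / 2))) ^ 2 =
      (t - s) ^ (2 * h) / (2 * h) * (1 / Real.Gamma (h + 1 / 2)) ^ 2 := by
    rw [div_pow, mul_pow, Real.sq_sqrt (by linarith), ← Real.rpow_natCast, ← Real.rpow_mul hts.le,
      mul_comm h]
    push_cast
    field_simp
  set σ := (t - s) ^ h / (√(2 * h) * Real.Gamma (h + 1 / 2)) with hσ
  rw [eLpNorm_eq_lintegral_rpow_enorm_toReal (by norm_num) (by norm_num)]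
  simp only [ENNReal.toReal_ofNat, ENNReal.rpow_two]
  rw [one_div (2 : ℝ), ENNReal.le_rpow_inv_iff (by norm_num), ENNReal.rpow_two,
    ← ENNReal.ofReal_pow hnn, hsq, ← hint, ← intervalIntegral.integral_mul_const,
    intervalIntegral.integral_of_le hst.le, ofReal_integral_eq_lintegral_ofReal
      ((hii.mul_const _).1) ?_]
  · refine le_trans (le_of_eq ?_) (setLIntegral_le_lintegral (Set.Ioo s t) _)
    rw [← restrict_Ioo_eq_restrict_Ioc]
    refine setLIntegral_congr_fun measurableSet_Ioo fun u hu => ?_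
    have e1 : movingAverageKernel h' s u = 0 := by
      simp [movingAverageKernel, not_lt.2 hu.1.le, not_lt.2 (hs.trans hu.1.le)]
    have e2 : movingAverageKernel h t u = 1 / Real.Gamma (h + 1 / 2) * (t - u) ^ (h - 1 / 2) := by
      simp [movingAverageKernel, hu.2, not_lt.2 (hs.trans hu.1.le)]
    simp only [e1, e2, sub_zero]
    rw [← ofReal_norm, ← ENNReal.ofReal_pow (norm_nonneg _), Real.norm_eq_abs, sq_abs,
      mul_pow, ← Real.rpow_natCast ((t - u) ^ _), ← Real.rpow_mul (by linarith [hu.2]), mul_comm]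
    congr 3
    push_cast
    ring
  · filter_upwards [ae_restrict_mem measurableSet_Ioc] with u hu
    have : 0 ≤ t - u := by linarith [hu.2]
    simp only [Pi.zero_apply]
    positivity

theorem not_memLp_movingAverageKernel {h t : ℝ} (h1 : 1 ≤ h) (ht : 0 < t) :
    ¬ MemLp (movingAverageKernel h t) 2 := by
  intro hk
  have hΓ : 0 < Real.Gamma (h + 1 / 2) := Real.Gamma_pos_of_pos (by linarith)
  have h2 := (hk.comp_measurePreserving
    (Measure.measurePreserving_neg (volume : Measure ℝ))).integrable_sq
  refine not_integrableOn_Ioi_inv (a := t + 1)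
    (((h2.integrableOn (s := Set.Ioi (t + 1))).const_mul
      (8 * Real.Gamma (h + 1 / 2) ^ 2 / t ^ 2)).mono' (by fun_prop) ?_)
  filter_upwards [ae_restrict_mem measurableSet_Ioi] with y hy
  have hy1 : t + 1 < y := hy
  have hy0 : 0 < y := by linarith
  have hyt : 0 < y + t := by linarith
  rw [Real.norm_of_nonneg (inv_nonneg.2 hy0.le)]
  simp only [Function.comp_apply, movingAverageKernel_eq, neg_neg, truncPow,
    hy0, hyt, if_true]
  set p := h - 1 / 2 with hp
  have hp2 : 1 / 2 ≤ p := by linarith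
  have key : √(y + t) - √y ≤ (y + t) ^ p - y ^ p := by
    have e1 : (y + t) ^ p = y ^ p * (1 + t / y) ^ p := by
      rw [← Real.mul_rpow hy0.le (by positivity)]; congr 1; field_simp
    have e2 : √(y + t) = √y * √(1 + t / y) := by
      rw [← Real.sqrt_mul hy0.le]; congr 1; field_simp
    have l1 : √y ≤ y ^ p := by
      rw [Real.sqrt_eq_rpow]; exact Real.rpow_le_rpow_of_exponent_le (by linarith) hp2
    have hx : 1 ≤ 1 + t / y := by have := div_pos ht hy0; linarith
    have l2 : √(1 + t / y) ≤ (1 + t / y) ^ p := by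
      rw [Real.sqrt_eq_rpow]; exact Real.rpow_le_rpow_of_exponent_le hx hp2
    have l3 : 1 ≤ √(1 + t / y) := Real.one_le_sqrt.2 hx
    rw [e1, e2]
    nlinarith [Real.sqrt_nonneg y]
  have hs : t ^ 2 / (8 * y) ≤ (√(y + t) - √y) ^ 2 := by
    have a1 := Real.sq_sqrt hy0.le
    have a2 := Real.sq_sqrt hyt.le
    have a0 := Real.sqrt_pos.2 hy0
    have a3 : √y ≤ √(y + t) := Real.sqrt_le_sqrt (by linarith)
    rw [div_le_iff₀ (by positivity)]
    have : t ^ 2 = (√(y + t) - √y) ^ 2 * (√(y + t) + √y) ^ 2 := by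
      rw [← mul_pow]; congr 1; nlinarith
    rw [this]
    gcongr
    nlinarith
  have hs' : t ^ 2 / (8 * y) ≤ ((y + t) ^ p - y ^ p) ^ 2 :=
    hs.trans (by
      have : √y ≤ √(y + t) := Real.sqrt_le_sqrt (by linarith)
      gcongr)
  calc y⁻¹ = 8 / t ^ 2 * (t ^ 2 / (8 * y)) := by field_simp
    _ ≤ 8 / t ^ 2 * ((y + t) ^ p - y ^ p) ^ 2 := by gcongr
    _ = _ := by field_simp

theorem not_memLp_harmonizableKernel {h t : ℝ} (h1 : 1 ≤ h) (ht : 0 < t) :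
    ¬ MemLp (harmonizableKernel h t) 2 := by
  intro hk
  have h2 := (memLp_two_iff_integrable_sq_norm hk.aestronglyMeasurable).1 hk
  set δ := min 1 (1 / t) with hδ
  have hδ0 : 0 < δ := by positivity
  have hni : ¬ IntegrableOn (fun x : ℝ => x⁻¹) (Set.Ioc 0 δ) := by
    rw [← intervalIntegrable_iff_integrableOn_Ioc_of_le hδ0.le, intervalIntegrable_inv_iff]
    simp [hδ0.ne, hδ0.le]
  refine hni (((h2.integrableOn (s := Set.Ioc 0 δ)).const_mul (4 / t ^ 2)).mono' (by fun_prop) ?_)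
  filter_upwards [ae_restrict_mem measurableSet_Ioc] with y hy
  have hy0 : 0 < y := hy.1
  have hy1 : y ≤ 1 := hy.2.trans (min_le_left _ _)
  have hyt : t * y ≤ 1 := by
    have := hy.2.trans (min_le_right _ _)
    rw [le_div_iff₀ ht] at this
    linarith
  rw [Real.norm_of_nonneg (inv_nonneg.2 hy0.le)]
  have hnum : t * y / 2 ≤ ‖Complex.exp (Complex.I * t * y) - 1‖ := by
    have him : (Complex.exp (Complex.I * t * y) - 1).im = Real.sin (t * y) := by
      have : Complex.I * t * y = ((t * y : ℝ) : ℂ) * Complex.I := by push_cast; ring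
      rw [this, Complex.sub_im, Complex.exp_ofReal_mul_I_im]
      simp
    have hsin := Real.mul_le_sin (x := t * y) (by positivity) (by linarith [Real.pi_gt_three])
    have h2pi : 1 / 2 ≤ 2 / Real.pi := by
      rw [div_le_div_iff₀ (by norm_num) Real.pi_pos]; linarith [Real.pi_le_four]
    calc t * y / 2 = 1 / 2 * (t * y) := by ring
      _ ≤ 2 / Real.pi * (t * y) := by gcongr
      _ ≤ _ := hsin.trans (him ▸ (le_abs_self _).trans (Complex.abs_im_le_norm _))
  have hden : y ^ (h + 1 / 2) ≤ y ^ (3 / 2 : ℝ) :=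
    Real.rpow_le_rpow_of_exponent_ge hy0 hy1 (by linarith)
  have hden' : (y ^ (h + 1 / 2)) ^ 2 ≤ y ^ 3 := by
    calc (y ^ (h + 1 / 2)) ^ 2 ≤ (y ^ (3 / 2 : ℝ)) ^ 2 := by gcongr
      _ = y ^ 3 := by
        rw [← Real.rpow_natCast, ← Real.rpow_mul hy0.le, ← Real.rpow_natCast]; norm_num
  unfold harmonizableKernel
  rw [norm_div, Complex.norm_real, Real.norm_of_nonneg (by positivity), abs_of_pos hy0, div_pow]
  calc y⁻¹ = 4 / t ^ 2 * ((t * y / 2) ^ 2 / y ^ 3) := by field_simp; norm_num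
    _ ≤ _ := by gcongr

/-! ### Local times of processes with integrable small ball probabilities -/

theorem measurableEmbedding_nnreal_coe : MeasurableEmbedding ((↑) : ℝ≥0 → ℝ) :=
  MeasurableEmbedding.subtype_coe measurableSet_Ici

theorem lebesgue_apply (s : Set ℝ≥0) : lebesgue s = volume (((↑) : ℝ≥0 → ℝ) '' s) :=
  measurableEmbedding_nnreal_coe.comap_apply _ _

theorem lebesgue_ae_ne (s : ℝ≥0) : ∀ᵐ t ∂lebesgue, t ≠ s := by
  have h : lebesgue {s} = 0 := by simp [lebesgue_apply]
  filter_upwards [measure_eq_zero_iff_ae_notMem.1 h] with t ht using ht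

theorem map_coe_lebesgue_restrict_Icc_le (a b : ℝ≥0) :
    (lebesgue.restrict (Set.Icc a b)).map ((↑) : ℝ≥0 → ℝ) ≤ volume.restrict (Set.Iic (b : ℝ)) := by
  refine Measure.le_iff.2 fun s hs => ?_
  rw [Measure.map_apply measurable_coe_nnreal_real hs,
    Measure.restrict_apply (measurable_coe_nnreal_real hs), Measure.restrict_apply hs,
    lebesgue_apply]
  refine measure_mono ?_
  rintro _ ⟨x, ⟨h1, h2⟩, rfl⟩
  exact ⟨h1, NNReal.coe_le_coe.2 h2.2⟩

theorem lebesgue_Icc_lt_top (a b : ℝ≥0) : lebesgue (Set.Icc a b) < ∞ := by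
  rw [lebesgue_apply]
  refine (measure_mono (t := Set.Icc (a : ℝ) b) ?_).trans_lt (by simp)
  rintro _ ⟨x, hx, rfl⟩
  exact ⟨NNReal.coe_le_coe.2 hx.1, NNReal.coe_le_coe.2 hx.2⟩

variable {Ω : Type*} [MeasurableSpace Ω] {P : Measure Ω} {B : ℝ≥0 → Ω → ℝ}

theorem hasSquareIntegrableLocalTime_of_measure_abs_sub_le [IsProbabilityMeasure P]
    (hB : Measurable (Function.uncurry B)) {I : Set ℝ≥0} (hI : lebesgue I < ∞) {D : ℝ≥0∞}
    (hD : D < ∞) (h : ∀ r : ℝ, 0 < r →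
      ∫⁻ s in I, ∫⁻ t in I, P {ω | |B t ω - B s ω| ≤ r} ∂lebesgue ∂lebesgue ≤
        ENNReal.ofReal r * D) :
    HasSquareIntegrableLocalTime P B I ∧
      ∫⁻ ω, ∫⁻ x, localTime (fun s => B s ω) I x ^ 2 ∂volume ∂P < ∞ := by
  have : IsFiniteMeasure (lebesgue.restrict I) := ⟨by simpa using hI⟩
  let r : ℕ → ℝ := fun k => 1 / ((k : ℝ) + 1)
  have hr : ∀ k, 0 < r k := fun k => Nat.one_div_pos_of_nat
  have hr0 : Tendsto r atTop (𝓝 0) := tendsto_one_div_add_atTop_nhds_zero_nat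
  have hBω : ∀ ω, Measurable fun s => B s ω := fun ω => hB.comp measurable_prodMk_right
  let m : Ω → Measure ℝ := fun ω => occupationMeasure (fun s => B s ω) I
  have hmfin : ∀ ω, IsFiniteMeasure (m ω) := fun ω => by
    unfold m occupationMeasure; infer_instance
  let J : ℕ → Ω → ℝ≥0∞ := fun k ω => (ENNReal.ofReal (2 * r k))⁻¹ *
    ∫⁻ s in I, lebesgue.restrict I {t | |B t ω - B s ω| ≤ 2 * r k} ∂lebesgue
  have hset : ∀ c : ℝ, MeasurableSet {p : (Ω × ℝ≥0) × ℝ≥0 | |B p.2 p.1.1 - B p.1.2 p.1.1| ≤ c} := by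
    intro c
    have m1 : Measurable fun p : (Ω × ℝ≥0) × ℝ≥0 => B p.2 p.1.1 :=
      hB.comp (measurable_snd.prodMk (measurable_fst.comp measurable_fst))
    have m2 : Measurable fun p : (Ω × ℝ≥0) × ℝ≥0 => B p.1.2 p.1.1 :=
      hB.comp ((measurable_snd.comp measurable_fst).prodMk (measurable_fst.comp measurable_fst))
    exact measurableSet_le (by fun_prop) measurable_const
  have hmeas : ∀ c : ℝ, Measurable fun p : Ω × ℝ≥0 =>
      lebesgue.restrict I {t | |B t p.1 - B p.2 p.1| ≤ c} := fun c =>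
    measurable_measure_prodMk_left (ν := lebesgue.restrict I) (hset c)
  have hJm : ∀ k, Measurable (J k) := fun k =>
    (hmeas (2 * r k)).lintegral_prod_right'.const_mul _
  have hratio : ∀ k ω, ∫⁻ x, (m ω (Metric.closedBall x (r k)) /
      volume (Metric.closedBall x (r k))) ^ 2 ≤ J k ω := by
    intro k ω
    refine (lintegral_closedBall_ratio_sq_le (m ω) (hr k)).trans (le_of_eq ?_)
    simp only [J]
    congr 1
    have hball : MeasurableSet {p : ℝ × ℝ | p.2 ∈ Metric.closedBall p.1 (2 * r k)} := by
      simp only [Metric.mem_closedBall]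
      exact measurableSet_le (by fun_prop) (by fun_prop)
    have hmb : Measurable fun y => m ω (Metric.closedBall y (2 * r k)) :=
      measurable_measure_prodMk_left (ν := m ω) hball
    have e : ∫⁻ y, m ω (Metric.closedBall y (2 * r k)) ∂(m ω) =
        ∫⁻ s in I, m ω (Metric.closedBall (B s ω) (2 * r k)) ∂lebesgue :=
      lintegral_map hmb (hBω ω)
    rw [e]
    refine lintegral_congr fun s => ?_
    simp only [m, occupationMeasure]
    rw [Measure.map_apply (hBω ω) measurableSet_closedBall]
    rfl
  have hJint : ∀ k, ∫⁻ ω, J k ω ∂P ≤ D := by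
    intro k
    have hc : 0 < 2 * r k := mul_pos two_pos (hr k)
    simp only [J]
    rw [lintegral_const_mul _ (hmeas (2 * r k)).lintegral_prod_right',
      lintegral_lintegral_swap (hmeas (2 * r k)).aemeasurable]
    have e : ∀ s, ∫⁻ ω, lebesgue.restrict I {t | |B t ω - B s ω| ≤ 2 * r k} ∂P =
        ∫⁻ t in I, P {ω | |B t ω - B s ω| ≤ 2 * r k} ∂lebesgue := by
      intro s
      have hs : MeasurableSet {p : Ω × ℝ≥0 | |B p.2 p.1 - B s p.1| ≤ 2 * r k} :=
        (measurable_fst.prodMk measurable_const).prodMk measurable_snd (hset (2 * r k))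
      exact (Measure.prod_apply (μ := P) (ν := lebesgue.restrict I) hs).symm.trans
        (Measure.prod_apply_symm hs)
    simp only [e]
    calc _ ≤ (ENNReal.ofReal (2 * r k))⁻¹ * (ENNReal.ofReal (2 * r k) * D) := by
          gcongr; exact h _ hc
      _ = D := by
        rw [← mul_assoc, ENNReal.inv_mul_cancel (by simpa using hr k) ENNReal.ofReal_ne_top,
          one_mul]
  have hliminf : ∫⁻ ω, liminf (fun k => J k ω) atTop ∂P < ∞ := by
    refine ((lintegral_liminf_le hJm).trans ?_).trans_lt hD
    exact liminf_le_of_frequently_le' (Frequently.of_forall hJint)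
  have hle : ∀ ω, liminf (fun k => ∫⁻ x, (m ω (Metric.closedBall x (r k)) /
      volume (Metric.closedBall x (r k))) ^ 2) atTop ≤ liminf (fun k => J k ω) atTop := fun ω =>
    liminf_le_liminf (Eventually.of_forall fun k => hratio k ω)
  have hloc : ∀ ω, ∫⁻ x, localTime (fun s => B s ω) I x ^ 2 ≤
      liminf (fun k => J k ω) atTop := fun ω =>
    (lintegral_rnDeriv_sq_le_liminf (m ω) hr hr0).trans (hle ω)
  refine ⟨?_, (lintegral_mono hloc).trans_lt hliminf⟩
  filter_upwards [ae_lt_top (.liminf hJm) hliminf.ne] with ω hω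
  exact ⟨absolutelyContinuous_of_liminf_lt_top (m ω) hr hr0 ((hle ω).trans_lt hω),
    (hloc ω).trans_lt hω⟩

/-! ### Small increments of the moving average multifractional Brownian motion -/

theorem IsMovingAverageMBm.exists_measure_abs_sub_le [IsProbabilityMeasure P] {H : ℝ≥0 → ℝ}
    (hB : ∀ t, Measurable (B t)) {μ ν : ℝ} (hμ : 0 < μ) (hν : ν < 1)
    (hH : ∀ t, H t ∈ Set.Icc μ ν) (hmBm : IsMovingAverageMBm P H B) :
    ∃ K : ℝ, 0 ≤ K ∧ ∀ s t : ℝ≥0, s < t → ∀ r : ℝ, 0 < r →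
      P {ω | |B t ω - B s ω| ≤ r} ≤
        ENNReal.ofReal (r * (K * (truncPow 0 (t - s) + truncPow (-ν) (t - s)))) := by
  obtain ⟨W, hW, hint⟩ := hmBm
  have hcont : ContinuousOn (fun h : ℝ => √(2 * h) * Real.Gamma (h + 1 / 2)) (Set.Icc μ ν) := by
    refine ContinuousOn.mul (by fun_prop) fun h hh => ?_
    have hd : ContinuousAt Real.Gamma (h + 1 / 2) :=
      (Real.differentiableAt_Gamma fun m => by
        have : (0 : ℝ) ≤ m := m.cast_nonneg
        linarith [hh.1]).continuousAt
    exact (hd.comp (f := fun h : ℝ => h + 1 / 2) (by fun_prop)).continuousWithinAt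
  obtain ⟨K, hK⟩ := isCompact_Icc.bddAbove_image hcont
  refine ⟨4 * max K 0, by positivity, fun s t hst r hr => ?_⟩
  have hst' : (s : ℝ) < t := hst
  have hx : 0 < (t : ℝ) - s := by linarith
  have hh0 : ∀ t, 0 < H t := fun t => hμ.trans_le (hH t).1
  have hΓ : 0 < Real.Gamma (H t + 1 / 2) := Real.Gamma_pos_of_pos (by linarith [hh0 t])
  have hKt : √(2 * H t) * Real.Gamma (H t + 1 / 2) ≤ max K 0 :=
    (hK ⟨H t, hH t, rfl⟩).trans (le_max_left _ _)
  have hsq : 0 < √(2 * H t) := Real.sqrt_pos.2 (by linarith [hh0 t])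
  have hσ : 0 < ((t : ℝ) - s) ^ H t / (√(2 * H t) * Real.Gamma (H t + 1 / 2)) := by positivity
  refine (IsWienerIntegral.measure_abs_sub_le hW
    (memLp_movingAverageKernel (hh0 t) ((hH t).2.trans_lt hν) t.2)
    (memLp_movingAverageKernel (hh0 s) ((hH s).2.trans_lt hν) s.2) (hB t) (hB s)
    (hint t) (hint s) hr hσ
    (le_eLpNorm_movingAverageKernel_sub (hh0 t) s.2 hst')).trans (ENNReal.ofReal_le_ofReal ?_)
  have hpow : ((t : ℝ) - s) ^ (-H t) ≤ truncPow 0 (t - s) + truncPow (-ν) (t - s) := by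
    simp only [truncPow, hx, if_true, Real.rpow_zero]
    rcases le_total 1 ((t : ℝ) - s) with h1 | h1
    · have := Real.rpow_le_one_of_one_le_of_nonpos h1 (neg_nonpos.2 (hh0 t).le)
      have := Real.rpow_nonneg hx.le (-ν)
      linarith
    · have := Real.rpow_le_rpow_of_exponent_ge hx h1 (neg_le_neg (hH t).2)
      linarith
  have e : 4 * r / (((t : ℝ) - s) ^ H t / (√(2 * H t) * Real.Gamma (H t + 1 / 2))) =
      r * (4 * (√(2 * H t) * Real.Gamma (H t + 1 / 2)) * ((t : ℝ) - s) ^ (-H t)) := by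
    rw [Real.rpow_neg hx.le]
    field_simp
  rw [e]
  gcongr

theorem lintegral_truncPow_sub_le {p : ℝ} (hp : -1 < p) (a b : ℝ≥0) :
    ∃ D : ℝ≥0∞, D < ∞ ∧ ∀ s ∈ Set.Icc a b,
      ∫⁻ t in Set.Icc a b, ENNReal.ofReal (truncPow p (t - s)) ∂lebesgue ≤ D ∧
      ∫⁻ t in Set.Icc a b, ENNReal.ofReal (truncPow p (s - t)) ∂lebesgue ≤ D := by
  have hm := (measurable_truncPow p).ennreal_ofReal
  have hc : Measurable ((↑) : ℝ≥0 → ℝ) := measurable_coe_nnreal_real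
  refine ⟨∫⁻ y in Set.Iic (b : ℝ), ENNReal.ofReal (truncPow p y),
    (integrableOn_truncPow hp b).lintegral_lt_top, fun s hs => ⟨?_, ?_⟩⟩
  · calc ∫⁻ t in Set.Icc a b, ENNReal.ofReal (truncPow p (t - s)) ∂lebesgue
        = ∫⁻ x, ENNReal.ofReal (truncPow p (x - s))
            ∂((lebesgue.restrict (Set.Icc a b)).map ((↑) : ℝ≥0 → ℝ)) :=
          (lintegral_map (hm.comp (measurable_id.sub_const _)) hc).symm
      _ ≤ ∫⁻ x in Set.Iic (b : ℝ), ENNReal.ofReal (truncPow p (x - s)) :=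
          lintegral_mono' (map_coe_lebesgue_restrict_Icc_le a b) le_rfl
      _ ≤ ∫⁻ x, (Set.Iic (b : ℝ)).indicator (fun y => ENNReal.ofReal (truncPow p y)) (x - s) := by
          rw [← lintegral_indicator measurableSet_Iic]
          refine lintegral_mono fun x => ?_
          by_cases hx : x ≤ b
          · have : x - s ≤ b := by linarith [s.2]
            simp [Set.indicator, hx, this]
          · simp [Set.indicator, hx]
      _ = _ := by
          rw [lintegral_sub_right_eq_self
            ((Set.Iic (b : ℝ)).indicator fun y => ENNReal.ofReal (truncPow p y)),
            lintegral_indicator measurableSet_Iic]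
  · calc ∫⁻ t in Set.Icc a b, ENNReal.ofReal (truncPow p (s - t)) ∂lebesgue
        = ∫⁻ t in Set.Icc a b, (Set.Iic (b : ℝ)).indicator
            (fun y => ENNReal.ofReal (truncPow p y)) (s - t) ∂lebesgue := by
          refine lintegral_congr fun t => ?_
          have hsb : (s : ℝ) ≤ b := hs.2
          have : (s : ℝ) - t ≤ b := by linarith [t.2]
          simp [Set.indicator, this]
      _ = ∫⁻ x, (Set.Iic (b : ℝ)).indicator (fun y => ENNReal.ofReal (truncPow p y)) (s - x)
            ∂((lebesgue.restrict (Set.Icc a b)).map ((↑) : ℝ≥0 → ℝ)) :=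
          (lintegral_map ((hm.indicator measurableSet_Iic).comp
            (measurable_const.sub measurable_id)) hc).symm
      _ ≤ ∫⁻ x, (Set.Iic (b : ℝ)).indicator (fun y => ENNReal.ofReal (truncPow p y)) (s - x) :=
          lintegral_mono' ((map_coe_lebesgue_restrict_Icc_le a b).trans
            Measure.restrict_le_self) le_rfl
      _ = _ := by
          rw [lintegral_sub_left_eq_self
            ((Set.Iic (b : ℝ)).indicator fun y => ENNReal.ofReal (truncPow p y)),
            lintegral_indicator measurableSet_Iic]

theorem IsMovingAverageMBm.hasSquareIntegrableLocalTime [IsProbabilityMeasure P] {H : ℝ≥0 → ℝ}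
    (hB : Measurable (Function.uncurry B)) {μ ν : ℝ} (hμ : 0 < μ) (hν : ν < 1)
    (hH : ∀ t, H t ∈ Set.Icc μ ν) (hmBm : IsMovingAverageMBm P H B) (a b : ℝ≥0) :
    HasSquareIntegrableLocalTime P B (Set.Icc a b) ∧
      ∫⁻ ω, ∫⁻ x, localTime (fun s => B s ω) (Set.Icc a b) x ^ 2 ∂volume ∂P < ∞ := by
  obtain ⟨K, hK, hsmall⟩ := hmBm.exists_measure_abs_sub_le
    (fun t => show Measurable (B t) from hB.comp measurable_prodMk_left) hμ hν hH
  obtain ⟨D₀, hD₀, h₀⟩ := lintegral_truncPow_sub_le (p := 0) (by norm_num) a b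
  obtain ⟨D₁, hD₁, h₁⟩ := lintegral_truncPow_sub_le (p := -ν) (by linarith) a b
  have hnn : ∀ p y, 0 ≤ truncPow p y := fun p y => by
    unfold truncPow; split_ifs <;> positivity
  have hmt : ∀ p (s : ℝ≥0), Measurable fun t : ℝ≥0 => ENNReal.ofReal (truncPow p (t - s)) :=
    fun p s => ((measurable_truncPow p).comp
      (measurable_coe_nnreal_real.sub_const _)).ennreal_ofReal
  have hmt' : ∀ p (s : ℝ≥0), Measurable fun t : ℝ≥0 => ENNReal.ofReal (truncPow p (s - t)) :=
    fun p s => ((measurable_truncPow p).comp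
      (measurable_const.sub measurable_coe_nnreal_real)).ennreal_ofReal
  have hpt : ∀ s t : ℝ≥0, t ≠ s → ∀ r : ℝ, 0 < r → P {ω | |B t ω - B s ω| ≤ r} ≤
      ENNReal.ofReal r * ENNReal.ofReal K *
        ((ENNReal.ofReal (truncPow 0 (t - s)) + ENNReal.ofReal (truncPow (-ν) (t - s))) +
        (ENNReal.ofReal (truncPow 0 (s - t)) + ENNReal.ofReal (truncPow (-ν) (s - t)))) := by
    intro s t hne r hr
    rcases lt_or_gt_of_ne hne with h | h
    · have := hsmall t s h r hr
      rw [ENNReal.ofReal_mul hr.le, ENNReal.ofReal_mul hK,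
        ENNReal.ofReal_add (hnn _ _) (hnn _ _), ← mul_assoc] at this
      simp only [abs_sub_comm (B s _) (B t _)] at this
      exact this.trans (mul_le_mul_right le_add_self _)
    · have := hsmall s t h r hr
      rw [ENNReal.ofReal_mul hr.le, ENNReal.ofReal_mul hK,
        ENNReal.ofReal_add (hnn _ _) (hnn _ _), ← mul_assoc] at this
      exact this.trans (mul_le_mul_right le_self_add _)
  have hinner : ∀ r : ℝ, 0 < r → ∀ s ∈ Set.Icc a b,
      ∫⁻ t in Set.Icc a b, P {ω | |B t ω - B s ω| ≤ r} ∂lebesgue ≤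
        ENNReal.ofReal r * (ENNReal.ofReal K * ((D₀ + D₁) + (D₀ + D₁))) := by
    intro r hr s hs
    have hae := ae_restrict_of_ae (s := Set.Icc a b) (lebesgue_ae_ne s)
    have hm₁ := (hmt 0 s).add (hmt (-ν) s)
    have hm₂ := (hmt' 0 s).add (hmt' (-ν) s)
    have hm := hm₁.add hm₂
    simp only [Pi.add_def] at hm₁ hm₂ hm
    refine (lintegral_mono_ae (hae.mono fun t ht => hpt s t ht r hr)).trans ?_
    rw [lintegral_const_mul _ hm, lintegral_add_left hm₁, lintegral_add_left (hmt 0 s),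
      lintegral_add_left (hmt' 0 s), mul_assoc]
    gcongr
    exacts [(h₀ s hs).1, (h₁ s hs).1, (h₀ s hs).2, (h₁ s hs).2]
  refine hasSquareIntegrableLocalTime_of_measure_abs_sub_le hB (lebesgue_Icc_lt_top a b)
    (D := ENNReal.ofReal K * ((D₀ + D₁) + (D₀ + D₁)) * lebesgue (Set.Icc a b)) ?_ fun r hr => ?_
  · refine ENNReal.mul_lt_top (ENNReal.mul_lt_top ENNReal.ofReal_lt_top ?_)
      (lebesgue_Icc_lt_top a b)
    simp [hD₀, hD₁]
  · refine (setLIntegral_mono measurable_const (hinner r hr)).trans (le_of_eq ?_)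
    rw [setLIntegral_const, mul_assoc]

/-! ### Hurst functions reaching values above one -/

theorem ae_notMem_of_ae_eq_zero [IsProbabilityMeasure P] (hB : Measurable (Function.uncurry B))
    {S : Set ℝ≥0} (hS : MeasurableSet S) (hSB : ∀ t ∈ S, ∀ᵐ ω ∂P, B t ω = 0)
    (hL : ∀ b : ℝ≥0, HasSquareIntegrableLocalTime P B (Set.Icc 0 b)) :
    ∀ᵐ t ∂lebesgue, t ∉ S := by
  have hcover : S = ⋃ n : ℕ, S ∩ Set.Icc 0 (n : ℝ≥0) := by
    ext t
    obtain ⟨n, hn⟩ := exists_nat_ge t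
    simp only [Set.mem_iUnion, Set.mem_inter_iff]
    exact ⟨fun h => ⟨n, h, zero_le, hn⟩, fun ⟨_, h, _⟩ => h⟩
  refine measure_eq_zero_iff_ae_notMem.1 ?_
  rw [hcover]
  refine measure_iUnion_null fun n => ?_
  have hset : MeasurableSet {p : Ω × ℝ≥0 | B p.2 p.1 = 0} :=
    (hB.comp measurable_swap) (measurableSet_singleton 0)
  have : IsFiniteMeasure (lebesgue.restrict (S ∩ Set.Icc 0 (n : ℝ≥0))) :=
    ⟨by simpa using (measure_mono Set.inter_subset_right).trans_lt (lebesgue_Icc_lt_top 0 n)⟩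
  have hae : ∀ᵐ ω ∂P, ∀ᵐ t ∂lebesgue.restrict (S ∩ Set.Icc 0 (n : ℝ≥0)), B t ω = 0 := by
    refine Measure.ae_ae_comm (p := fun ω t => B t ω = 0) hset |>.2 ?_
    filter_upwards [ae_restrict_mem (hS.inter measurableSet_Icc)] with t ht using hSB t ht.1
  obtain ⟨ω, hω, hac, -⟩ := (hae.and (hL n)).exists
  have hBω : Measurable fun s => B s ω := hB.comp measurable_prodMk_right
  have h0 := hac (Real.volume_singleton (a := 0))
  rw [occupationMeasure, Measure.map_apply hBω (measurableSet_singleton 0),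
    Measure.restrict_apply (hBω (measurableSet_singleton 0))] at h0
  rw [ae_restrict_iff' (hS.inter measurableSet_Icc)] at hω
  refine measure_mono_null_ae ?_ h0
  filter_upwards [hω] with t ht hmem using ⟨ht hmem, hmem.2⟩

theorem HurstCondition.continuous {β : ℝ≥0} {H : ℝ≥0 → ℝ} (hH : HurstCondition β H)
    (hpos : ∀ t, 0 < H t) : Continuous H := by
  obtain ⟨⟨C, hC⟩, hbdd, hsup⟩ := hH
  have hβ : (0 : ℝ) < β := ((hpos 0).trans_le (le_ciSup hbdd 0)).trans hsup
  exact hC.continuous (by exact_mod_cast hβ)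

end MBm

theorem theorem3p1 {Ω : Type*} [MeasurableSpace Ω] (P : Measure Ω) [IsProbabilityMeasure P]
    (H : ℝ≥0 → ℝ) (B : ℝ≥0 → Ω → ℝ) (hB : Measurable (Function.uncurry B)) :
    (∀ μ ν : ℝ, 0 < μ → ν < 1 → Measurable H → (∀ t, H t ∈ Set.Icc μ ν) →
      MBm.IsMovingAverageMBm P H B →
      ∀ a b : ℝ≥0, a ≤ b →
        MBm.HasSquareIntegrableLocalTime P B (Set.Icc a b) ∧
        ∫⁻ ω, ∫⁻ x, MBm.localTime (fun s => B s ω) (Set.Icc a b) x ^ 2 ∂volume ∂P < ∞) ∧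
    (∀ β : ℝ≥0, (∀ t, 0 < H t) → MBm.HurstCondition β H →
      (MBm.IsMovingAverageMBm P H B ∨ MBm.IsHarmonizableMBm P H B) →
      (∀ a b : ℝ≥0, a ≤ b → MBm.HasSquareIntegrableLocalTime P B (Set.Icc a b)) →
      ∀ᵐ t ∂MBm.lebesgue, H t < 1) := by
  refine ⟨fun μ ν hμ hν _ hH hmBm a b _ => hmBm.hasSquareIntegrableLocalTime hB hμ hν hH a b,
    fun β hpos hHβ hmBm hL => ?_⟩
  have hcont := hHβ.continuous hpos
  have hzero : ∀ t ∈ {t | 1 ≤ H t} ∩ Set.Ioi 0, ∀ᵐ ω ∂P, B t ω = 0 := by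
    rintro t ⟨h1, ht⟩
    have ht' : (0 : ℝ) < t := ht
    rcases hmBm with ⟨W, -, hint⟩ | ⟨e, η, -, -, hint⟩
    · exact ((hint t).resolve_left fun h => MBm.not_memLp_movingAverageKernel h1 ht' h.1).2
    · exact ((hint t).resolve_left fun h => MBm.not_memLp_harmonizableKernel h1 ht' h.1).2
  have hS : MeasurableSet ({t | 1 ≤ H t} ∩ Set.Ioi (0 : ℝ≥0)) :=
    (measurableSet_le measurable_const hcont.measurable).inter measurableSet_Ioi
  filter_upwards [MBm.ae_notMem_of_ae_eq_zero hB hS hzero fun b => hL 0 b zero_le,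
    MBm.lebesgue_ae_ne 0] with t ht ht0
  by_contra hcon
  exact ht ⟨not_lt.1 hcon, pos_iff_ne_zero.2 ht0⟩
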